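/- Let $r>1$ be an integer. There are an integer $t\ge 1$, an integer $k\le 3\cdot 2^{r-2}$ and a constant $c>0$, all depending only on $r$, such that for every integer $n>1$ there are an integer $N$ and an $\mathbb F_{2^t}$-linear $k$-query locally decodable code $C:\mathbb F_{2^t}^n\to\mathbb F_{2^t}^N$ of length $$N=\exp\Bigl(\exp\Bigl(O\bigl(\sqrt[r]{\log n\,(\log\log n)^{r-1}}\bigr)\Bigr)\Bigr)=\exp\Bigl(n^{O((\log\log n/\log n)^{1-1/r})}\Bigr).$$ Here the length bound means: for every $n\ge 3$ there is $\theta\in[0,c]$ with $$N=\exp\Bigl(\exp\bigl(\theta\,(\log n\,(\log\log n)^{r-1})^{1/r}\bigr)\Bigr)=\exp\Bigl(n^{\theta(\log\log n/\log n)^{1-1/r}}\Bigr)$$ (natural logarithms; for $n=2$ the existence of the code is asserted without a bound on $N$). That $C$ is a $k$-query locally decodable code means the following, where a decoder is a randomized algorithm that chooses at most $k$ positions of a word $y\in\mathbb F_{2^t}^N$ nonadaptively (all of them before any answer is seen), reads $y$ there, and outputs an element of $\mathbb F_{2^t}$. 1. $C$ has a perfectly smooth decoder with at most $k$ queries: for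 each $i\in\{1,\dots,n\}$ there is a decoder $D_i$ such that $\Pr[D_i(C(x))=x_i]=1$ for all $x\in\mathbb F_{2^t}^n$, and each query of $D_i$ is uniformly distributed over $\{1,\dots,N\}$. 2. For every $\delta\ge 0$, $C$ is a $(k,\delta,k\delta)$-locally decodable code: for each $i$ there is a decoder $D_i$ such that $\Pr[D_i(y)=x_i]\ge 1-k\delta$ for all $x\in\mathbb F_{2^t}^n$ and all $y\in\mathbb F_{2^t}^N$ that differ from $C(x)$ in at most $\delta N$ coordinates. -/

import Mathlib

open scoped ENNReal

/-- A deterministic nonadaptive decoding procedure making `l` queries to a word of length `N`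
over `F`: the positions to be read, all fixed in advance (repetitions are allowed), and the
symbol that is output, as a function of the answers. -/
structure QueryPlan (F : Type*) (N l : ℕ) where
  query : Fin l → Fin N
  output : (Fin l → F) → F

/-- The output on the word `y`; only the `l` queried coordinates of `y` are looked at. -/
def QueryPlan.run {F : Type*} {N l : ℕ} (s : QueryPlan F N l) (y : Fin N → F) : F :=
  s.output fun j => y (s.query j)

/-- A randomized nonadaptive decoding algorithm with `l` queries: the coin tosses select a
deterministic procedure (positions and output function jointly). -/
abbrev RandomizedDecoder (F : Type*) (N l : ℕ) := PMF (QueryPlan F N l)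

/-- The distribution of the output of `D` on the word `y`. -/
noncomputable def RandomizedDecoder.outputDist {F : Type*} {N l : ℕ}
    (D : RandomizedDecoder F N l) (y : Fin N → F) : PMF F :=
  PMF.map (fun s => s.run y) D

/-- The distribution of the position of the `j`-th query of `D`. -/
noncomputable def RandomizedDecoder.queryDist {F : Type*} {N l : ℕ}
    (D : RandomizedDecoder F N l) (j : Fin l) : PMF (Fin N) :=
  PMF.map (fun s => s.query j) D

open scoped Classical in
/-- `C` is a (nonadaptive) `(k, δ, ε)`-locally decodable code: for each `i` there is a
randomized decoder making at most `k` queries that, for every message `x` and every word `y`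
at Hamming distance at most `δ N` from `C x`, outputs `x i` with probability at least `1 - ε`. -/
def IsLocallyDecodable {F : Type*} {n N : ℕ} (C : (Fin n → F) → (Fin N → F))
    (k : ℕ) (δ ε : ℝ) : Prop :=
  ∀ i : Fin n, ∃ l : ℕ, l ≤ k ∧ ∃ D : RandomizedDecoder F N l,
    ∀ (x : Fin n → F) (y : Fin N → F), (hammingDist (C x) y : ℝ) ≤ δ * (N : ℝ) →
      1 - ε ≤ (D.outputDist y (x i)).toReal

/-- `C` has a perfectly smooth (nonadaptive) decoder making at most `k` queries: on a codeword
`C x` the `i`-th decoder outputs `x i` with probability one, and each of its queries is uniformly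
distributed over the `N` coordinates. -/
def HasPerfectlySmoothDecoder {F : Type*} {n N : ℕ} (C : (Fin n → F) → (Fin N → F))
    (k : ℕ) : Prop :=
  ∀ i : Fin n, ∃ l : ℕ, l ≤ k ∧ ∃ D : RandomizedDecoder F N l,
    (∀ x : Fin n → F, D.outputDist (C x) (x i) = 1) ∧
      ∀ (j : Fin l) (p : Fin N), D.queryDist j p = (N : ℝ≥0∞)⁻¹

/-! Let characters `χ j` of a finite abelian group `G` be given, with points `g i q` and weights `a
q` such that `∑ q, a q * χ j (g i q)` is 1 for `j = i` and 0 otherwise. Encode `x` as the function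
`v ↦ ∑ j, x j * χ j v` on `G`. To recover `x i`, pick `v` uniformly, read at the shifts `v + g i q`,
combine with the weights and divide by `χ i v`. Every query is uniform, so this decoder is perfectly
smooth, and the union bound gives local decodability.

Messages are indexed by functions `f : Fin w → Fin w`, where `w` has order `log n / log log n`. Two
functions are equal iff they agree in `w` places. For `r` primes `p`, take prime powers `p ^ e` just
above `w ^ (1 / r)`. Their product exceeds `w`, so equality is the conjunction of `r` congruences on
the agreement. Each congruence is detected by a dot product over `ZMod p` in a dimension of at most
`(w ^ 2 + 1) ^ (p ^ e)`, which gives the length (`exists_matching_vectors`).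

Conjunction multiplies the numbers of queries. A single prime costs two queries, but 7 and 73
together cost only three, because of a trinomial over a field containing the 511th roots of unity
(`hasCharacterSystem_agreeMod_seven`). The total is `3 * 2 ^ (r - 2)`. -/

/-! ### From smooth decoding to local decoding -/

/-- By the union bound, a perfectly smooth decoder with `k` queries errs with probability at most
`k * δ` on a word at relative distance `δ` from a codeword. -/
theorem HasPerfectlySmoothDecoder.isLocallyDecodable {F : Type*} {n N : ℕ}
    {C : (Fin n → F) → (Fin N → F)} {k : ℕ} (h : HasPerfectlySmoothDecoder C k) {δ : ℝ}
    (hδ : 0 ≤ δ) : IsLocallyDecodable C k δ ((k : ℝ) * δ) := by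
  classical
  intro i
  obtain ⟨l, hl, D, hD, hq⟩ := h i
  refine ⟨l, hl, D, fun x y hxy => ?_⟩
  set B : Finset (Fin N) := Finset.univ.filter fun p => C x p ≠ y p with hB
  have hBδ : (B.card : ℝ) ≤ δ * N := by
    convert hxy using 2
    simp [hB, hammingDist]
  have hbad : ∀ j : Fin l,
      D.toOuterMeasure ((fun s => s.query j) ⁻¹' (B : Set (Fin N))) ≤ ENNReal.ofReal δ := by
    intro j
    rw [← PMF.toOuterMeasure_map_apply]
    change (D.queryDist j).toOuterMeasure _ ≤ _
    rw [PMF.toOuterMeasure_apply_finset, Finset.sum_congr rfl fun p _ => hq j p]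
    rw [Finset.sum_const, nsmul_eq_mul]
    obtain ⟨p⟩ : Nonempty (Fin N) := by
      obtain ⟨s, -⟩ := D.support_nonempty
      exact ⟨s.query j⟩
    have hN : 0 < N := p.pos
    rw [← div_eq_mul_inv]
    refine ENNReal.div_le_of_le_mul ?_
    have := ENNReal.ofReal_le_ofReal hBδ
    rwa [ENNReal.ofReal_natCast, ENNReal.ofReal_mul hδ, ENNReal.ofReal_natCast] at this
  have hgood : D.toOuterMeasure ((fun s => s.run (C x)) ⁻¹' {x i}) = 1 := by
    rw [← PMF.toOuterMeasure_map_apply, PMF.toOuterMeasure_apply_singleton]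
    exact hD x
  -- A run that meets no corrupted position gives the same output on `y` as on `C x`.
  have hsub : ((fun s : QueryPlan F N l => s.run (C x)) ⁻¹' {x i}) ⊆
      ((fun s => s.run y) ⁻¹' {x i}) ∪
        ⋃ j ∈ (Finset.univ : Finset (Fin l)), (fun s => s.query j) ⁻¹' (B : Set (Fin N)) := by
    intro s hs
    by_cases hs' : ∀ j, C x (s.query j) = y (s.query j)
    · left
      simpa [QueryPlan.run, hs'] using hs
    · right
      push Not at hs'
      simpa [hB] using hs'
  have hle : 1 ≤ D.outputDist y (x i) + ENNReal.ofReal (k * δ) := by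
    calc (1 : ℝ≥0∞) = D.toOuterMeasure ((fun s => s.run (C x)) ⁻¹' {x i}) := hgood.symm
      _ ≤ _ := MeasureTheory.measure_mono hsub
      _ ≤ _ := MeasureTheory.measure_union_le _ _
      _ ≤ D.outputDist y (x i) + ENNReal.ofReal (k * δ) := by
        refine add_le_add ?_ ?_
        · rw [← PMF.toOuterMeasure_map_apply, PMF.toOuterMeasure_apply_singleton]
          rfl
        · refine (MeasureTheory.measure_biUnion_finset_le _ _).trans ?_
          refine (Finset.sum_le_sum fun j _ => hbad j).trans ?_
          rw [Finset.sum_const, Finset.card_univ, Fintype.card_fin, nsmul_eq_mul,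
            ENNReal.ofReal_mul (by positivity), ENNReal.ofReal_natCast]
          gcongr
  have hlt := (D.outputDist y).apply_ne_top (x i)
  have := ENNReal.toReal_mono (by finiteness) hle
  rw [ENNReal.toReal_one, ENNReal.toReal_add hlt (by finiteness),
    ENNReal.toReal_ofReal (by positivity)] at this
  linarith

/-! ### Character systems and the codes they define -/

/-- The image of the uniform distribution under a bijection is uniform. -/
theorem PMF.map_uniformOfFintype_equiv_apply {α β : Type*} [Fintype α] [Nonempty α]
    (e : α ≃ β) (b : β) :
    (PMF.uniformOfFintype α).map e b = (Fintype.card α : ℝ≥0∞)⁻¹ := by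
  classical
  rw [PMF.map_apply, tsum_eq_single (e.symm b)]
  · simp
  · intro a ha
    rw [if_neg]
    rintro rfl
    simp at ha

/-- `HasCharacterSystem F k N W` says that some finite abelian group of order `N` carries
characters `χ j`, and points `g i q` with weights `a q` for `q < k`, such that
`∑ q, a q * χ j (g i q)` is the indicator of the relation `W i j`. -/
def HasCharacterSystem (F : Type*) [Field F] {ι : Type*} (k N : ℕ) (W : ι → ι → Prop) : Prop :=
  ∃ (G : Type) (_ : AddCommGroup G) (_ : Fintype G), Fintype.card G = N ∧
    ∃ (χ : ι → AddChar G F) (g : ι → Fin k → G) (a : Fin k → F),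
      ∀ i j, (W i j → ∑ q, a q * χ j (g i q) = 1) ∧ (¬ W i j → ∑ q, a q * χ j (g i q) = 0)

/-- The external product of two characters. -/
def AddChar.prodMul {G₁ G₂ M : Type*} [AddMonoid G₁] [AddMonoid G₂] [CommMonoid M]
    (χ₁ : AddChar G₁ M) (χ₂ : AddChar G₂ M) : AddChar (G₁ × G₂) M :=
  χ₁.compAddMonoidHom (AddMonoidHom.fst G₁ G₂) * χ₂.compAddMonoidHom (AddMonoidHom.snd G₁ G₂)

theorem AddChar.prodMul_apply {G₁ G₂ M : Type*} [AddMonoid G₁] [AddMonoid G₂] [CommMonoid M]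
    (χ₁ : AddChar G₁ M) (χ₂ : AddChar G₂ M) (x : G₁) (y : G₂) :
    χ₁.prodMul χ₂ (x, y) = χ₁ x * χ₂ y := rfl

namespace HasCharacterSystem

variable {F : Type*} [Field F] {ι κ : Type*}

theorem comp {k N : ℕ} {W : ι → ι → Prop} (h : HasCharacterSystem F k N W) (f : κ → ι) :
    HasCharacterSystem F k N fun i j => W (f i) (f j) := by
  obtain ⟨G, i1, i2, hN, χ, g, a, H⟩ := h
  exact ⟨G, i1, i2, hN, χ ∘ f, g ∘ f, a, fun i j => H _ _⟩

theorem congr {k N : ℕ} {W W' : ι → ι → Prop} (h : HasCharacterSystem F k N W)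
    (hW : ∀ i j, W i j ↔ W' i j) : HasCharacterSystem F k N W' := by
  have : W = W' := by ext i j; exact hW i j
  rwa [← this]

theorem one : HasCharacterSystem F 1 1 fun _ _ : ι => True :=
  ⟨PUnit, inferInstance, inferInstance, rfl, fun _ => 0, fun _ _ => 0, fun _ => 1, by simp⟩

/-- On the product group, with products of characters and of weights, the double sum factors, so the
two indicators multiply. -/
theorem and {k₁ k₂ N₁ N₂ : ℕ} {W₁ W₂ : ι → ι → Prop} (h₁ : HasCharacterSystem F k₁ N₁ W₁)
    (h₂ : HasCharacterSystem F k₂ N₂ W₂) :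
    HasCharacterSystem F (k₁ * k₂) (N₁ * N₂) fun i j => W₁ i j ∧ W₂ i j := by
  obtain ⟨G₁, _, _, hN₁, χ₁, g₁, a₁, H₁⟩ := h₁
  obtain ⟨G₂, _, _, hN₂, χ₂, g₂, a₂, H₂⟩ := h₂
  refine ⟨G₁ × G₂, inferInstance, inferInstance, by rw [Fintype.card_prod, hN₁, hN₂],
    fun j => (χ₁ j).prodMul (χ₂ j),
    fun i q => (g₁ i (finProdFinEquiv.symm q).1, g₂ i (finProdFinEquiv.symm q).2),
    fun q => a₁ (finProdFinEquiv.symm q).1 * a₂ (finProdFinEquiv.symm q).2, fun i j => ?_⟩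
  have key : ∑ q : Fin (k₁ * k₂), (a₁ (finProdFinEquiv.symm q).1 * a₂ (finProdFinEquiv.symm q).2) *
      (χ₁ j).prodMul (χ₂ j)
        (g₁ i (finProdFinEquiv.symm q).1, g₂ i (finProdFinEquiv.symm q).2) =
      (∑ q, a₁ q * χ₁ j (g₁ i q)) * ∑ q, a₂ q * χ₂ j (g₂ i q) := by
    rw [Finset.sum_mul_sum, ← Fintype.sum_prod_type', ← finProdFinEquiv.symm.sum_comp]
    refine Finset.sum_congr rfl fun q _ => ?_
    rw [AddChar.prodMul_apply]
    ring
  rw [key]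
  by_cases hW₁ : W₁ i j <;> by_cases hW₂ : W₂ i j <;> simp [hW₁, hW₂, H₁ i j, H₂ i j]

theorem forall_mem_finset {α : Type*} (s : Finset α) {k : ℕ} {N : α → ℕ} {W : α → ι → ι → Prop}
    (h : ∀ p ∈ s, HasCharacterSystem F k (N p) (W p)) :
    HasCharacterSystem F (k ^ s.card) (∏ p ∈ s, N p) fun i j => ∀ p ∈ s, W p i j := by
  classical
  induction s using Finset.induction_on with
  | empty => simpa using one
  | insert p s hp ih =>
    rw [Finset.prod_insert hp, Finset.card_insert_of_notMem hp, pow_succ']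
    exact ((h p (by simp)).and (ih fun q hq => h q (by simp [hq]))).congr (by simp)

/-- A character system for equality yields a linear code with a perfectly smooth decoder. -/
theorem exists_code {n k N : ℕ} (h : HasCharacterSystem F k N fun i j : Fin n => i = j) :
    ∃ C : (Fin n → F) →ₗ[F] (Fin N → F), HasPerfectlySmoothDecoder C k := by
  obtain ⟨G, _, _, rfl, χ, g, a, H⟩ := h
  let e := Fintype.equivFin G
  let C : (Fin n → F) →ₗ[F] (Fin (Fintype.card G) → F) :=
    Fintype.linearCombination F fun j p => χ j (e.symm p)
  have hC : ∀ x v, C x (e v) = ∑ j, x j * χ j v := by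
    intro x v
    simp [C, Fintype.linearCombination_apply, Finset.sum_apply]
  refine ⟨C, fun i => ⟨k, le_rfl, (PMF.uniformOfFintype G).map fun v =>
    ⟨fun q => e (v + g i q), fun y => χ i (-v) * ∑ q, a q * y q⟩, fun x => ?_, fun q p => ?_⟩⟩
  · rw [RandomizedDecoder.outputDist, PMF.map_comp]
    have : ((fun s : QueryPlan F (Fintype.card G) k => s.run (C x)) ∘ fun v =>
        ⟨fun q => e (v + g i q), fun y => χ i (-v) * ∑ q, a q * y q⟩) =
        Function.const G (x i) := by
      ext v
      simp only [Function.comp_apply, QueryPlan.run, hC, Function.const_apply]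
      -- The shift by `v` factors out of each character, so the sum over `q` is the indicator of `i
      -- = j`.
      calc χ i (-v) * ∑ q, a q * ∑ j, x j * χ j (v + g i q)
          = χ i (-v) * ∑ j, x j * χ j v * ∑ q, a q * χ j (g i q) := by
            congr 1
            simp_rw [Finset.mul_sum]
            rw [Finset.sum_comm]
            refine Finset.sum_congr rfl fun j _ => Finset.sum_congr rfl fun q _ => ?_
            rw [AddChar.map_add_eq_mul]
            ring
        _ = χ i (-v) * (x i * χ i v) := by
            rw [Finset.sum_eq_single i]
            · rw [(H i i).1 rfl, mul_one]
            · intro j _ hj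
              rw [(H i j).2 (Ne.symm hj), mul_zero]
            · simp
        _ = x i := by
            rw [mul_left_comm, ← AddChar.map_add_eq_mul]
            simp
    rw [this, PMF.map_const]
    simp
  · rw [RandomizedDecoder.queryDist, PMF.map_comp]
    exact PMF.map_uniformOfFintype_equiv_apply ((Equiv.addRight (g i q)).trans e) p

end HasCharacterSystem

/-! ### Roots of unity in characteristic two -/

section FieldElements

open Polynomial

/-- Identities between powers of a root of `X ^ 9 + X ^ 4 + 1` in characteristic two. -/
theorem root_nonic_identities {R : Type*} [CommRing R] (h2 : (2 : R) = 0) {β : R}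
    (h : β ^ 9 = β ^ 4 + 1) :
    β ^ 511 = 1 ∧ β ^ 423 + β ^ 257 + β ^ 342 = 1 ∧ β ^ 488 + β ^ 269 + β ^ 342 = 0 ∧
      β ^ 131 + β ^ 38 + β ^ 342 = 0 := by
  -- Repeated squaring reduces the powers of `β` to polynomials of degree at most 8; the exponents
  -- needed are assembled from these.
  have h9 : β ^ 9 = β ^ 4 + 1 := h
  have h16 : β ^ 16 = β ^ 7 + β ^ 6 + β ^ 2 := by
    linear_combination β ^ 7 * h9 + (β ^ 2) * h
  have h32 : β ^ 32 = β ^ 7 + β ^ 5 + β ^ 3 + 1 := by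
    linear_combination β ^ 16 * h16 + (β ^ 7 + β ^ 6 + β ^ 2) * h16 + (β ^ 5 + 2 * β ^ 4 + β ^ 3 +
      3) * h + (2 * β ^ 8 + 3 * β ^ 4 + 1) * h2
  have h64 : β ^ 64 = β ^ 6 + β ^ 4 + β := by
    linear_combination β ^ 32 * h32 + (β ^ 7 + β ^ 5 + β ^ 3 + 1) * h32 + (β ^ 5 + 2 * β ^ 3 + 3 *
      β + 1) * h + (β ^ 8 + 2 * β ^ 7 + 3 * β ^ 5 + 2 * β ^ 3 + β + 1) * h2
  have h128 : β ^ 128 = β ^ 8 + β ^ 7 + β ^ 3 + β ^ 2 := by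
    linear_combination β ^ 64 * h64 + (β ^ 6 + β ^ 4 + β) * h64 + (β ^ 3 + 2 * β) * h + (β ^ 7 + 2
      * β ^ 5 + β) * h2
  have h256 : β ^ 256 = β ^ 7 + β ^ 5 + β ^ 2 + 1 := by
    linear_combination β ^ 128 * h128 + (β ^ 8 + β ^ 7 + β ^ 3 + β ^ 2) * h128 + (β ^ 7 + 2 * β ^
      6 + β ^ 5 + 3 * β ^ 2 + 6 * β + 3) * h + (3 * β ^ 6 + 4 * β ^ 5 + 2 * β ^ 4 + β ^ 2 + 3 * β
      + 1) * h2
  have h512 : β ^ 512 = β := by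
    linear_combination β ^ 256 * h256 + (β ^ 7 + β ^ 5 + β ^ 2 + 1) * h256 + (β ^ 5 + 2 * β ^ 3 +
      β + 3) * h + (3 * β ^ 7 + 2 * β ^ 5 + 2 * β ^ 4 + β ^ 3 + β ^ 2 + 2) * h2
  have h384 : β ^ 384 = β ^ 8 + β ^ 7 + β ^ 6 + β ^ 5 + β ^ 4 + β ^ 2 + β + 1 := by
    linear_combination β ^ 128 * h256 + (β ^ 7 + β ^ 5 + β ^ 2 + 1) * h128 + (β ^ 6 + β ^ 5 + β ^
      4 + β ^ 3 + 3 * β + 3) * h + (β ^ 8 + β ^ 7 + 2 * β ^ 5 + 2 * β ^ 4 + β ^ 3 + β + 1) * h2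
  have h448 : β ^ 448 = β ^ 6 + β ^ 5 + β ^ 4 + β ^ 3 + β ^ 2 + β + 1 := by
    linear_combination β ^ 64 * h384 + (β ^ 8 + β ^ 7 + β ^ 6 + β ^ 5 + β ^ 4 + β ^ 2 + β + 1) *
      h64 + (β ^ 5 + β ^ 4 + 2 * β ^ 3 + 2 * β ^ 2 + 2 * β + 3) * h + (2 * β ^ 8 + 2 * β ^ 7 + 2 *
      β ^ 6 + 2 * β ^ 5 + 2 * β ^ 4 + β ^ 3 + β ^ 2 + β + 1) * h2
  have h480 : β ^ 480 = β ^ 6 + β ^ 5 + β ^ 3 + β ^ 2 + β := by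
    linear_combination β ^ 32 * h448 + (β ^ 6 + β ^ 5 + β ^ 4 + β ^ 3 + β ^ 2 + β + 1) * h32 + (β
      ^ 4 + β ^ 3 + 2 * β ^ 2 + 2 * β + 3) * h + (2 * β ^ 8 + 2 * β ^ 7 + 2 * β ^ 6 + 2 * β ^ 5 +
      3 * β ^ 4 + β ^ 3 + β ^ 2 + β + 2) * h2
  have h488 : β ^ 488 = β ^ 8 + β ^ 6 + β ^ 4 + β ^ 2 + β := by
    linear_combination β ^ 8 * h480 + (β ^ 5 + β ^ 4 + β ^ 2 + β + 2) * h + (β ^ 5 + β ^ 4 + 1) *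
      h2
  have h269 : β ^ 269 = β ^ 6 + β ^ 4 + β ^ 2 + 1 := by
    linear_combination β ^ 13 * h256 + (β ^ 11 + β ^ 9 + 2 * β ^ 6 + 2 * β ^ 4 + β ^ 2 + 2 * β +
      1) * h + (β ^ 8 + β ^ 6 + β ^ 5 + β ^ 4 + β) * h2
  have h320 : β ^ 320 = β ^ 8 + β ^ 6 + β ^ 4 + β ^ 3 + β + 1 := by
    linear_combination β ^ 64 * h256 + (β ^ 7 + β ^ 5 + β ^ 2 + 1) * h64 + (β ^ 4 + 2 * β ^ 2 + 1)
      * h + (β ^ 8 + 2 * β ^ 6 + β ^ 4 + β ^ 2) * h2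
  have h336 : β ^ 336 = β ^ 8 + β ^ 7 + β ^ 4 := by
    linear_combination β ^ 16 * h320 + (β ^ 8 + β ^ 6 + β ^ 4 + β ^ 3 + β + 1) * h16 + (β ^ 6 + β
      ^ 5 + β ^ 4 + β ^ 3 + β ^ 2 + 4 * β + 2) * h + (β ^ 8 + β ^ 7 + 2 * β ^ 6 + 3 * β ^ 5 + β ^
      4 + β ^ 3 + β ^ 2 + 2 * β + 1) * h2
  have h342 : β ^ 342 = β ^ 8 + β + 1 := by
    linear_combination β ^ 6 * h336 + (β ^ 5 + β ^ 4 + β + 1) * h + (β ^ 5 + β ^ 4) * h2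
  have h416 : β ^ 416 = β ^ 8 + β ^ 5 + β ^ 3 + 1 := by
    linear_combination β ^ 32 * h384 + (β ^ 8 + β ^ 7 + β ^ 6 + β ^ 5 + β ^ 4 + β ^ 2 + β + 1) *
      h32 + (β ^ 6 + β ^ 5 + 2 * β ^ 4 + 2 * β ^ 3 + 3 * β ^ 2 + 3 * β + 4) * h + (2 * β ^ 8 + 3 *
      β ^ 7 + 3 * β ^ 6 + 3 * β ^ 5 + 4 * β ^ 4 + β ^ 3 + 2 * β ^ 2 + 2 * β + 2) * h2
  have h423 : β ^ 423 = β ^ 6 + β ^ 3 := by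
    linear_combination β ^ 7 * h416 + (β ^ 6 + β ^ 3 + 2 * β) * h + (β ^ 7 + β ^ 5 + β) * h2
  have h257 : β ^ 257 = β ^ 8 + β ^ 6 + β ^ 3 + β := by
    linear_combination β ^ 1 * h256
  have h131 : β ^ 131 = β ^ 2 + β := by
    linear_combination β ^ 3 * h128 + (β ^ 2 + β) * h + (β ^ 6 + β ^ 5) * h2
  have h38 : β ^ 38 = β ^ 8 + β ^ 2 + 1 := by
    linear_combination β ^ 6 * h32 + (β ^ 4 + β ^ 2 + 1) * h + (β ^ 6 + β ^ 4) * h2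
  refine ⟨?_, ?_, ?_, ?_⟩
  -- The inverse of `β` is `β ^ 8 - β ^ 3`, which turns `β ^ 512 = β` into `β ^ 511 = 1`.
  · linear_combination (β ^ 8 - β ^ 3) * h512 - (β ^ 511 - 1) * h
  · rw [h423, h257, h342]
    linear_combination (β ^ 8 + β ^ 6 + β ^ 3 + β) * h2
  · rw [h488, h269, h342]
    linear_combination (β ^ 8 + β ^ 6 + β ^ 4 + β ^ 2 + β + 1) * h2
  · rw [h131, h38, h342]
    linear_combination (β ^ 8 + β ^ 2 + β + 1) * h2

/-- A formal root `α` satisfies `α ^ 511 = 1`, and `511 = 2 ^ 9 - 1` divides `2 ^ t - 1`. Hence `α ^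
2 ^ t = α`, so the nonic divides the split polynomial `X ^ 2 ^ t - X`. -/
theorem GaloisField.exists_root_nonic {t : ℕ} (ht : t ≠ 0) (h9 : 9 ∣ t) :
    ∃ β : GaloisField 2 t, β ^ 9 = β ^ 4 + 1 := by
  have hcard : Nat.card (GaloisField 2 t) = 2 ^ t := GaloisField.card 2 t ht
  have hmonic : (X ^ 9 + X ^ 4 + 1 : (GaloisField 2 t)[X]).Monic := by monicity!
  have hdeg : (X ^ 9 + X ^ 4 + 1 : (GaloisField 2 t)[X]).natDegree = 9 := by compute_degree!
  have h2 : (2 : GaloisField 2 t) = 0 := CharTwo.two_eq_zero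
  have hdvd : (X ^ 9 + X ^ 4 + 1 : (GaloisField 2 t)[X]) ∣ X ^ 2 ^ t - X := by
    rw [← AdjoinRoot.mk_eq_zero]
    set α := AdjoinRoot.root (X ^ 9 + X ^ 4 + 1 : (GaloisField 2 t)[X]) with hα
    have h2' : (2 : AdjoinRoot (X ^ 9 + X ^ 4 + 1 : (GaloisField 2 t)[X])) = 0 := by
      have := congrArg (AdjoinRoot.of (X ^ 9 + X ^ 4 + 1 : (GaloisField 2 t)[X])) h2
      rwa [map_ofNat, map_zero] at this
    have hroot : α ^ 9 = α ^ 4 + 1 := by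
      have := AdjoinRoot.mk_self (f := (X ^ 9 + X ^ 4 + 1 : (GaloisField 2 t)[X]))
      simp only [map_add, map_pow, map_one, AdjoinRoot.mk_X] at this
      linear_combination this - (α ^ 4 + 1) * h2'
    have h511 := (root_nonic_identities h2' hroot).1
    have hd : 511 ∣ 2 ^ t - 1 := by
      obtain ⟨s, rfl⟩ := h9
      rw [pow_mul]
      simpa using Nat.sub_dvd_pow_sub_pow 512 1 s
    obtain ⟨s, hs⟩ := hd
    have hpos : 1 ≤ 2 ^ t := Nat.one_le_two_pow
    have h1 : 2 ^ t = 511 * s + 1 := by omega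
    simp only [map_sub, map_pow, AdjoinRoot.mk_X, ← hα]
    have h1' : α ^ (511 * s + 1) = α := by
      rw [pow_succ α, pow_mul α, h511, one_pow, one_mul]
    simpa only [h1] using sub_eq_zero.2 h1'
  have hne : (X ^ 2 ^ t - X : (GaloisField 2 t)[X]) ≠ 0 :=
    FiniteField.X_pow_card_pow_sub_X_ne_zero _ ht Nat.one_lt_two
  have hs : (X ^ 9 + X ^ 4 + 1 : (GaloisField 2 t)[X]).Splits := by
    refine Splits.of_dvd ?_ hne hdvd
    rw [← hcard]
    exact Polynomial.splits_X_pow_nat_card_sub_X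
  obtain ⟨β, hβ⟩ := hs.exists_eval_eq_zero (by
    rw [Polynomial.degree_eq_natDegree hmonic.ne_zero, hdeg]; norm_num)
  refine ⟨β, ?_⟩
  simp only [eval_add, eval_pow, eval_X, eval_one] at hβ
  linear_combination hβ - (β ^ 4 + 1) * h2

/-- By Fermat, `p` divides `2 ^ (p - 1) - 1`, hence the order `2 ^ t - 1` of the unit group;
Cauchy's theorem then applies. -/
theorem GaloisField.exists_root_of_unity {t p : ℕ} (ht : t ≠ 0) (hp : p.Prime) (hp2 : p ≠ 2)
    (hpt : p - 1 ∣ t) : ∃ ζ : GaloisField 2 t, ζ ^ p = 1 ∧ ζ ≠ 1 := by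
  have := Fact.mk hp
  have hcard : Nat.card (GaloisField 2 t)ˣ = 2 ^ t - 1 := by
    rw [Nat.card_units, GaloisField.card 2 t ht]
  have hdvd : p ∣ Nat.card (GaloisField 2 t)ˣ := by
    rw [hcard]
    obtain ⟨s, rfl⟩ := hpt
    have h1 : p ∣ 2 ^ (p - 1) - 1 := by
      rw [← Nat.modEq_iff_dvd' Nat.one_le_two_pow]
      refine (Nat.ModEq.symm ?_)
      rw [← Nat.totient_prime hp]
      exact Nat.ModEq.pow_totient ((Nat.coprime_primes Nat.prime_two hp).2 hp2.symm)
    refine h1.trans ?_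
    simpa [pow_mul] using Nat.sub_dvd_pow_sub_pow (2 ^ (p - 1)) 1 s
  obtain ⟨ζ, hζ⟩ := exists_prime_orderOf_dvd_card' p hdvd
  refine ⟨ζ, ?_, ?_⟩
  · rw [← Units.val_pow_eq_pow_val, ← hζ, pow_orderOf_eq_one, Units.val_one]
  · rw [Ne, Units.val_eq_one, ← orderOf_eq_one_iff, hζ]
    exact hp.ne_one

end FieldElements

/-! ### Matching vectors from agreement modulo prime powers -/

section MatchingVectors

open Finset fwdDiff_aux

/-- A function on `ℕ` with values in characteristic `p` and with period `p ^ e` is killed by the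
`p ^ e`-th iterated difference operator. -/
theorem fwdDiff_iter_eq_zero_of_periodic {p e : ℕ} [Fact p.Prime] {f : ℕ → ZMod p}
    (hf : Function.Periodic f (p ^ e)) {j : ℕ} (hj : p ^ e ≤ j) (y : ℕ) :
    (fwdDiff 1)^[j] f y = 0 := by
  have hp : (p : Module.End ℤ (ℕ → ZMod p)) = 0 := by
    ext g x
    simp
  have : CharP (Module.End ℤ (ℕ → ZMod p)) p := by
    have : Nontrivial (Module.End ℤ (ℕ → ZMod p)) := inferInstance
    exact ringChar.of_eq (CharP.ringChar_of_prime_eq_zero Fact.out hp)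
  have key : (fwdDiff 1)^[p ^ e] f = 0 := by
    have h1 : fwdDiffₗ ℕ (ZMod p) 1 = shiftₗ ℕ (ZMod p) 1 - 1 := by simp [shiftₗ]
    -- In characteristic `p`, `(S - 1) ^ p ^ e = S ^ p ^ e - 1` for the shift `S`, and periodicity
    -- makes this vanish on `f`.
    rw [← coe_fwdDiffₗ_pow, h1, sub_pow_char_pow_of_commute _ _ (Commute.one_right _)]
    ext y
    simp [shiftₗ_pow_apply, hf y]
  obtain ⟨i, rfl⟩ := Nat.exists_eq_add_of_le' hj
  rw [Function.iterate_add_apply, key, ← coe_fwdDiffₗ_pow, map_zero, Pi.zero_apply]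

/-- The graph of a function, as a finite set of pairs. -/
def graphFinset {w : ℕ} (f : Fin w → Fin w) : Finset (Fin w × Fin w) :=
  univ.image fun a => (a, f a)

theorem card_graphFinset {w : ℕ} (f : Fin w → Fin w) : (graphFinset f).card = w := by
  rw [graphFinset, card_image_of_injective _ fun a b h => (Prod.mk.inj h).1]
  simp

theorem card_graphFinset_inter_le {w : ℕ} (f g : Fin w → Fin w) :
    (graphFinset f ∩ graphFinset g).card ≤ w :=
  (card_le_card inter_subset_left).trans_eq (card_graphFinset f)

theorem eq_of_card_graphFinset_inter {w : ℕ} {f g : Fin w → Fin w}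
    (h : (graphFinset f ∩ graphFinset g).card = w) : f = g := by
  have h1 : graphFinset f ∩ graphFinset g = graphFinset f :=
    eq_of_subset_of_card_le inter_subset_left (by rw [h, card_graphFinset])
  ext a
  have h2 : (a, f a) ∈ graphFinset g := by
    have : (a, f a) ∈ graphFinset f := by simp [graphFinset]
    rw [← h1] at this
    exact (mem_inter.1 this).2
  simp only [graphFinset, mem_image, mem_univ, true_and, Prod.mk.injEq] at h2
  obtain ⟨b, rfl, hb⟩ := h2
  rw [hb]

/-- The agreement of `f` and `g` is `w` modulo `q`. -/
def AgreeMod {w : ℕ} (q : ℕ) (f g : Fin w → Fin w) : Prop :=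
  q ∣ w - (graphFinset f ∩ graphFinset g).card

/-- The number of sets of fewer than `q` pairs. -/
def smallSetCount (w q : ℕ) : ℕ := Fintype.card {T : Finset (Fin w × Fin w) // T.card < q}

theorem smallSetCount_pos {w q : ℕ} (hq : 0 < q) : 0 < smallSetCount w q :=
  Fintype.card_pos_iff.2 ⟨⟨∅, by simpa⟩⟩

/-- There are `(w ^ 2).choose j ≤ (w ^ 2) ^ j` sets of size `j`, and these powers are dominated by
the terms of the binomial expansion of `(w ^ 2 + 1) ^ q`. -/
theorem smallSetCount_le (w q : ℕ) : smallSetCount w q ≤ (w ^ 2 + 1) ^ q := by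
  classical
  rw [smallSetCount, Fintype.card_subtype,
    card_eq_sum_card_fiberwise (f := card) (t := range q) (by intro T; simp)]
  calc ∑ j ∈ range q, ({T ∈ {T : Finset (Fin w × Fin w) | T.card < q} | T.card = j} :
          Finset (Finset (Fin w × Fin w))).card
      ≤ ∑ j ∈ range q, (w ^ 2) ^ j := by
        refine sum_le_sum fun j _ => ?_
        refine (card_le_card (t := powersetCard j univ) ?_).trans ?_
        · intro T hT
          simp only [mem_filter, mem_powersetCard] at hT ⊢
          exact ⟨subset_univ _, hT.2⟩
        · rw [card_powersetCard, card_univ, Fintype.card_prod, Fintype.card_fin, ← sq]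
          exact Nat.choose_le_pow _ _
    _ ≤ ∑ j ∈ range (q + 1), (w ^ 2) ^ j * 1 ^ (q - j) * q.choose j := by
        refine (sum_le_sum_of_subset (range_subset_range.2 q.le_succ)).trans ?_
        refine sum_le_sum fun j hj => ?_
        rw [one_pow, mul_one]
        exact Nat.le_mul_of_pos_right _ (Nat.choose_pos (by simpa [Nat.lt_succ_iff] using hj))
    _ = (w ^ 2 + 1) ^ q := by rw [add_pow]; simp

/-- Vectors over `ZMod p`, indexed by sets of fewer than `p ^ e` pairs, whose pairwise products
detect whether the agreement of two functions is full modulo `p ^ e`. -/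
theorem exists_matching_vectors (w p e : ℕ) [Fact p.Prime] :
    ∃ u v : (Fin w → Fin w) → {T : Finset (Fin w × Fin w) // T.card < p ^ e} → ZMod p,
      ∀ f g, (AgreeMod (p ^ e) f g → u g ⬝ᵥ v f = 0) ∧ (¬ AgreeMod (p ^ e) f g → u g ⬝ᵥ v f = 1) := by
  classical
  let F : ℕ → ZMod p := fun z => if ((p ^ e : ℕ) : ℤ) ∣ (w : ℤ) - z then 0 else 1
  have hF : Function.Periodic F (p ^ e) := by
    intro z
    simp only [F]
    congr 1
    rw [Nat.cast_add, ← sub_sub, dvd_sub_self_right]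
  refine ⟨fun g T => if T.1 ⊆ graphFinset g then (fwdDiff 1)^[T.1.card] F 0 else 0,
    fun f T => if T.1 ⊆ graphFinset f then 1 else 0, fun f g => ?_⟩
  have key : (fun T : {T : Finset (Fin w × Fin w) // T.card < p ^ e} =>
      if T.1 ⊆ graphFinset g then (fwdDiff 1)^[T.1.card] F 0 else 0) ⬝ᵥ
      (fun T => if T.1 ⊆ graphFinset f then 1 else 0) =
      F (graphFinset f ∩ graphFinset g).card := by
    set I := graphFinset f ∩ graphFinset g with hI
    -- Newton's expansion writes `F I.card` as the sum over `j` of `I.card.choose j` times the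
    -- `j`-th difference at 0, that is, as a sum over the subsets `T` of `I`. Such a `T` lies in
    -- both graphs, which is a dot product; sets with at least `p ^ e` elements contribute nothing.
    have h1 := shift_eq_sum_fwdDiff_iter 1 F I.card 0
    rw [zero_add, smul_eq_mul, mul_one] at h1
    rw [h1, ← sum_powerset_apply_card (fun j => (fwdDiff 1)^[j] F 0) (x := I), dotProduct]
    rw [← sum_subtype (univ.filter fun T : Finset (Fin w × Fin w) => T.card < p ^ e) (by simp)
      (fun T => (if T ⊆ graphFinset g then (fwdDiff 1)^[T.card] F 0 else 0) *
        if T ⊆ graphFinset f then 1 else 0)]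
    have hI' : I.powerset = univ.filter fun T => T ⊆ I := by ext; simp
    rw [hI', sum_filter, sum_filter]
    refine sum_congr rfl fun T _ => ?_
    by_cases hT : T.card < p ^ e
    · by_cases hf : T ⊆ graphFinset f <;> by_cases hg : T ⊆ graphFinset g <;>
        simp [hT, hf, hg, hI, subset_inter_iff]
    · simp [hT, fwdDiff_iter_eq_zero_of_periodic hF (not_lt.1 hT)]
  rw [key]
  have hle := card_graphFinset_inter_le f g
  have hiff : AgreeMod (p ^ e) f g ↔
      ((p ^ e : ℕ) : ℤ) ∣ (w : ℤ) - ((graphFinset f ∩ graphFinset g).card : ℕ) := by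
    rw [AgreeMod, ← Nat.cast_sub hle, Int.natCast_dvd_natCast]
  exact ⟨fun h => if_pos (hiff.1 h), fun h => if_neg fun h' => h (hiff.2 h')⟩

section Dot

variable {F H : Type*} [Field F] [Fintype H] {p : ℕ} [NeZero p] {ζ : F}

/-- The character `x ↦ ζ ^ (u ⬝ᵥ x)`. -/
def dotChar (hζ : ζ ^ p = 1) (u : H → ZMod p) : AddChar (H → ZMod p) F :=
  (AddChar.zmodChar p hζ).compAddMonoidHom
    (AddMonoidHom.mk' (fun x => u ⬝ᵥ x) fun x y => dotProduct_add u x y)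

theorem dotChar_nsmul (hζ : ζ ^ p = 1) {u v : H → ZMod p} {s : ℕ} (h : u ⬝ᵥ v = s) (b : ℕ) :
    dotChar hζ u (b • v) = (ζ ^ s) ^ b := by
  rw [AddChar.map_nsmul_eq_pow]
  congr 1
  simp only [dotChar, AddChar.compAddMonoidHom_apply, AddMonoidHom.mk'_apply, h]
  exact AddChar.zmodChar_apply' hζ s

end Dot

/-- The dot products are 0 or 1, so the character takes the value 1 or `ζ` at `v f`. The weights are
the coefficients of `(X - ζ) / (1 - ζ)`, which is 1 at `X = 1` and 0 at `X = ζ`. -/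
theorem hasCharacterSystem_agreeMod {F : Type*} [Field F] {p : ℕ} (hp : p.Prime) {ζ : F}
    (hζ : ζ ^ p = 1) (hζ1 : ζ ≠ 1) (w e : ℕ) :
    HasCharacterSystem F 2 (p ^ smallSetCount w (p ^ e)) (AgreeMod (w := w) (p ^ e)) := by
  classical
  have := Fact.mk hp
  obtain ⟨u, v, huv⟩ := exists_matching_vectors w p e
  refine ⟨{T : Finset (Fin w × Fin w) // T.card < p ^ e} → ZMod p, inferInstance, inferInstance,
    by simp [smallSetCount, ZMod.card], fun g => dotChar hζ (u g), fun f => ![1 • v f, 0 • v f],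
    ![(1 - ζ)⁻¹, -ζ * (1 - ζ)⁻¹], fun f g => ⟨fun h => ?_, fun h => ?_⟩⟩
  · have h0 : u g ⬝ᵥ v f = (0 : ℕ) := by simpa using (huv f g).1 h
    have : 1 - ζ ≠ 0 := sub_ne_zero.2 hζ1.symm
    simp only [Fin.sum_univ_two, Matrix.cons_val_zero, Matrix.cons_val_one, dotChar_nsmul hζ h0]
    field_simp
    ring
  · have h1 : u g ⬝ᵥ v f = (1 : ℕ) := by simpa using (huv f g).2 h
    simp only [Fin.sum_univ_two, Matrix.cons_val_zero, Matrix.cons_val_one, dotChar_nsmul hζ h1]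
    ring

/-- The two dot products together yield one of the four values 1, `β ^ 147`, `β ^ 365`, `β`. The
trinomial `β ^ 423 * X ^ 65 + β ^ 257 * X ^ 12 + β ^ 342` is 1 at the first and 0 at the other
three. Its three terms give three queries, where treating the primes separately would cost four. -/
theorem hasCharacterSystem_agreeMod_seven {F : Type*} [Field F] (h2 : (2 : F) = 0) {β : F}
    (hβ : β ^ 9 = β ^ 4 + 1) (w e₁ e₂ : ℕ) :
    HasCharacterSystem F 3
      (7 ^ smallSetCount w (7 ^ e₁) * 73 ^ smallSetCount w (73 ^ e₂))
      fun f g : Fin w → Fin w => AgreeMod (7 ^ e₁) f g ∧ AgreeMod (73 ^ e₂) f g := by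
  classical
  have := Fact.mk (show Nat.Prime 7 by norm_num)
  have := Fact.mk (show Nat.Prime 73 by norm_num)
  obtain ⟨h511, hs, hs₁, hs₂⟩ := root_nonic_identities h2 hβ
  have hred : ∀ a b c, b = 511 * c + a → β ^ b = β ^ a := by
    rintro a b c rfl
    rw [pow_add, pow_mul, h511, one_pow, one_mul]
  obtain ⟨u₁, v₁, huv₁⟩ := exists_matching_vectors w 7 e₁
  obtain ⟨u₂, v₂, huv₂⟩ := exists_matching_vectors w 73 e₂
  -- The exponents are the idempotents modulo 511: 365 is 1 modulo 7 and 0 modulo 73, while 147 is 0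
  -- modulo 7 and 1 modulo 73.
  have hζ₁ : (β ^ 365) ^ 7 = 1 := by rw [← pow_mul, hred 0 _ 5 (by norm_num), pow_zero]
  have hζ₂ : (β ^ 147) ^ 73 = 1 := by rw [← pow_mul, hred 0 _ 21 (by norm_num), pow_zero]
  refine ⟨({T : Finset (Fin w × Fin w) // T.card < 7 ^ e₁} → ZMod 7) ×
    ({T : Finset (Fin w × Fin w) // T.card < 73 ^ e₂} → ZMod 73), inferInstance, inferInstance,
    by simp [smallSetCount, ZMod.card],
    fun g => (dotChar hζ₁ (u₁ g)).prodMul (dotChar hζ₂ (u₂ g)),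
    fun f q => (![65, 12, 0] q • v₁ f, ![65, 12, 0] q • v₂ f),
    ![β ^ 423, β ^ 257, β ^ 342], fun f g => ?_⟩
  have key : ∀ s₁ s₂ : ℕ, u₁ g ⬝ᵥ v₁ f = s₁ → u₂ g ⬝ᵥ v₂ f = s₂ →
      ∑ q, ![β ^ 423, β ^ 257, β ^ 342] q *
        (dotChar hζ₁ (u₁ g)).prodMul (dotChar hζ₂ (u₂ g))
          (![65, 12, 0] q • v₁ f, ![65, 12, 0] q • v₂ f) =
      β ^ (423 + 65 * (365 * s₁ + 147 * s₂)) + β ^ (257 + 12 * (365 * s₁ + 147 * s₂)) +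
        β ^ 342 := by
    intro s₁ s₂ h₁ h₂
    simp only [Fin.sum_univ_three, AddChar.prodMul_apply, dotChar_nsmul hζ₁ h₁, dotChar_nsmul hζ₂ h₂,
      Matrix.cons_val_zero, Matrix.cons_val_one, Matrix.cons_val]
    ring
  have h₁ : u₁ g ⬝ᵥ v₁ f = ((if AgreeMod (7 ^ e₁) f g then 0 else 1 : ℕ) : ZMod 7) := by
    split_ifs with h
    · simpa using (huv₁ f g).1 h
    · simpa using (huv₁ f g).2 h
  have h₂ : u₂ g ⬝ᵥ v₂ f = ((if AgreeMod (73 ^ e₂) f g then 0 else 1 : ℕ) : ZMod 73) := by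
    split_ifs with h
    · simpa using (huv₂ f g).1 h
    · simpa using (huv₂ f g).2 h
  rw [key _ _ h₁ h₂]
  by_cases hW₁ : AgreeMod (7 ^ e₁) f g <;> by_cases hW₂ : AgreeMod (73 ^ e₂) f g <;>
    simp only [hW₁, hW₂, and_self, and_true, and_false, if_true, if_false, not_true, not_false_iff,
      false_imp_iff, true_imp_iff, true_and]
  · exact hs
  -- At `X = β ^ 147` the two nonconstant terms are those at `X = β`, interchanged.
  · rw [hred 269 (423 + 65 * (365 * 0 + 147 * 1)) 19 (by norm_num),
      hred 488 (257 + 12 * (365 * 0 + 147 * 1)) 3 (by norm_num),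
      ← hs₁]
    ring
  · rw [hred 131 (423 + 65 * (365 * 1 + 147 * 0)) 47 (by norm_num),
      hred 38 (257 + 12 * (365 * 1 + 147 * 0)) 9 (by norm_num),
      hs₂]
  · rw [hred 488 (423 + 65 * (365 * 1 + 147 * 1)) 65 (by norm_num),
      hred 269 (257 + 12 * (365 * 1 + 147 * 1)) 12 (by norm_num),
      hs₁]

end MatchingVectors

/-! ### Combining `r` primes into a code -/

section CodeFamily

open Finset

theorem exists_code_family (r : ℕ) (hr : 1 < r) :
    ∃ t M : ℕ, 0 < t ∧ 3 ≤ M ∧ ∀ w n : ℕ, 0 < w → n ≤ w ^ w →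
      ∃ (N : ℕ) (C : (Fin n → GaloisField 2 t) →ₗ[GaloisField 2 t] (Fin N → GaloisField 2 t)),
        HasPerfectlySmoothDecoder C (3 * 2 ^ (r - 2)) ∧ 3 ≤ N ∧
          Real.log N ≤ ((w : ℝ) ^ 2 + 1) ^ (M * (w : ℝ) ^ (1 / (r : ℝ))) * Real.log M := by
  have hinf : {p : ℕ | 73 < p ∧ p.Prime}.Infinite := by
    rw [Set.infinite_iff_exists_gt]
    intro a
    obtain ⟨p, hp, hp'⟩ := Nat.exists_infinite_primes (a + 74)
    exact ⟨p, ⟨by omega, hp'⟩, by omega⟩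
  obtain ⟨P, hPsub, hPcard⟩ := hinf.exists_subset_card_eq (r - 2)
  have hP : ∀ p ∈ P, 73 < p ∧ p.Prime := fun p hp => hPsub hp
  have h73 : 73 ∉ P := fun h => lt_irrefl _ (hP 73 h).1
  have h7 : 7 ∉ insert 73 P := by
    intro h
    rcases mem_insert.1 h with h | h
    · norm_num at h
    · have := (hP 7 h).1
      omega
  set S : Finset ℕ := insert 7 (insert 73 P) with hS
  have hSprime : ∀ p ∈ S, p.Prime := by
    intro p hp
    rcases mem_insert.1 hp with rfl | hp
    · norm_num
    rcases mem_insert.1 hp with rfl | hp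
    · norm_num
    exact (hP p hp).2
  have hScard : S.card = r := by
    rw [hS, card_insert_of_notMem h7, card_insert_of_notMem h73, hPcard]
    omega
  set t := 9 * ∏ p ∈ P, (p - 1) with ht
  have ht0 : 0 < t := by
    refine Nat.mul_pos (by norm_num) (prod_pos fun p hp => ?_)
    have := (hP p hp).1
    omega
  have hMpos : 0 < ∏ p ∈ S, p := prod_pos fun p hp => (hSprime p hp).pos
  have hle : ∀ p ∈ S, p ≤ ∏ p ∈ S, p := fun p hp =>
    Nat.le_of_dvd hMpos (dvd_prod_of_mem _ hp)
  have h7S : 7 ∈ S := mem_insert_self _ _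
  refine ⟨t, ∏ p ∈ S, p, ht0, (by norm_num : 3 ≤ 7).trans (hle 7 h7S), fun w n hw hn => ?_⟩
  -- Each modulus `p ^ e p` is chosen in the interval from `x` to `p * x`: large enough that `r` of
  -- them multiply to more than `x ^ r = w`, small enough to bound the dimension.
  set x : ℝ := (w : ℝ) ^ (1 / (r : ℝ)) with hx
  have hw1 : (1 : ℝ) ≤ w := by exact_mod_cast hw
  have hx1 : 1 ≤ x := Real.one_le_rpow hw1 (by positivity)
  have hxr : x ^ r = w := by
    rw [hx, one_div, Real.rpow_inv_natCast_pow (by positivity) (by omega)]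
  have hexp : ∀ p : ℕ, ∃ e : ℕ, 1 < p → x < (p : ℝ) ^ e ∧ (p : ℝ) ^ e ≤ p * x := by
    intro p
    by_cases hp : 1 < p
    · obtain ⟨e, he, he'⟩ := exists_nat_pow_near hx1 (y := (p : ℝ)) (by exact_mod_cast hp)
      refine ⟨e + 1, fun _ => ⟨he', ?_⟩⟩
      rw [pow_succ']
      gcongr
    · exact ⟨0, fun h => absurd h hp⟩
  choose e he using hexp
  obtain ⟨β, hβ⟩ := GaloisField.exists_root_nonic ht0.ne' (dvd_mul_right 9 _)
  have hsys := (hasCharacterSystem_agreeMod_seven CharTwo.two_eq_zero hβ w (e 7) (e 73)).and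
    (HasCharacterSystem.forall_mem_finset P (N := fun p => p ^ smallSetCount w (p ^ e p))
      (W := fun p => AgreeMod (p ^ e p)) fun p hp => by
        obtain ⟨ζ, hζ, hζ1⟩ := GaloisField.exists_root_of_unity ht0.ne' (hP p hp).2
          (by have := (hP p hp).1; omega)
          ((dvd_prod_of_mem (fun p => p - 1) hp).trans (dvd_mul_left _ 9))
        exact hasCharacterSystem_agreeMod (hP p hp).2 hζ hζ1 w (e p))
  have hprod : w < ∏ p ∈ S, p ^ e p := by
    have : (w : ℝ) < ∏ p ∈ S, (p : ℝ) ^ e p := by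
      rw [← hxr, ← hScard, ← prod_const]
      exact prod_lt_prod_of_nonempty (fun _ _ => by positivity)
        (fun p hp => (he p (hSprime p hp).one_lt).1) ⟨7, h7S⟩
    exact_mod_cast this
  -- The deficit `w - agreement` is divisible by pairwise coprime moduli whose product exceeds `w`,
  -- so it is zero.
  have hfull : ∀ f g : Fin w → Fin w,
      ((AgreeMod (7 ^ e 7) f g ∧ AgreeMod (73 ^ e 73) f g) ∧ ∀ p ∈ P, AgreeMod (p ^ e p) f g) ↔
        f = g := by
    intro f g
    constructor
    · rintro ⟨⟨h₁, h₂⟩, h₃⟩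
      have hall : ∀ p ∈ S, p ^ e p ∣ w - (graphFinset f ∩ graphFinset g).card := by
        intro p hp
        rcases mem_insert.1 hp with rfl | hp
        · exact h₁
        rcases mem_insert.1 hp with rfl | hp
        · exact h₂
        exact h₃ p hp
      have hdvd : ∏ p ∈ S, p ^ e p ∣ w - (graphFinset f ∩ graphFinset g).card := by
        refine prod_dvd_of_isRelPrime (fun p hp q hq hpq => ?_) hall
        exact Nat.coprime_iff_isRelPrime.1
          (Nat.Coprime.pow _ _ ((Nat.coprime_primes (hSprime p hp) (hSprime q hq)).2 hpq))
      have h0 := Nat.eq_zero_of_dvd_of_lt hdvd ((Nat.sub_le _ _).trans_lt hprod)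
      have hc := card_graphFinset_inter_le f g
      exact eq_of_card_graphFinset_inter (by omega)
    · rintro rfl
      simp [AgreeMod, card_graphFinset]
  obtain ⟨emb⟩ : Nonempty (Fin n ↪ (Fin w → Fin w)) := by
    rw [Function.Embedding.nonempty_iff_card_le]
    simpa using hn
  obtain ⟨C, hC⟩ := ((hsys.congr hfull).comp emb).congr (fun i j => emb.injective.eq_iff)
    |>.exists_code
  have hN : 7 ^ smallSetCount w (7 ^ e 7) * 73 ^ smallSetCount w (73 ^ e 73) *
      ∏ p ∈ P, p ^ smallSetCount w (p ^ e p) = ∏ p ∈ S, p ^ smallSetCount w (p ^ e p) := by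
    rw [hS, prod_insert h7, prod_insert h73, mul_assoc]
  refine ⟨_, C, by rwa [hPcard] at hC, ?_, ?_⟩
  · rw [hN]
    refine (by norm_num : 3 ≤ 7).trans (Nat.le_of_dvd
      (prod_pos fun p hp => Nat.pow_pos (hSprime p hp).pos) ?_)
    exact (dvd_pow_self 7 (smallSetCount_pos (by positivity)).ne').trans
      (dvd_prod_of_mem (fun p => p ^ smallSetCount w (p ^ e p)) h7S)
  · rw [hN]
    push_cast
    have hpos : ∀ p ∈ S, (0 : ℝ) < p := fun p hp => by exact_mod_cast (hSprime p hp).pos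
    rw [Real.log_prod fun p hp => (pow_pos (hpos p hp) _).ne',
      Real.log_prod fun p hp => (hpos p hp).ne', mul_sum]
    refine sum_le_sum fun p hp => ?_
    rw [Real.log_pow]
    have hlog : 0 ≤ Real.log p := Real.log_natCast_nonneg p
    refine mul_le_mul_of_nonneg_right ?_ hlog
    have hb : (smallSetCount w (p ^ e p) : ℝ) ≤ ((w : ℝ) ^ 2 + 1) ^ (p ^ e p) := by
      exact_mod_cast smallSetCount_le w (p ^ e p)
    refine hb.trans ?_
    rw [← Real.rpow_natCast]
    refine Real.rpow_le_rpow_of_exponent_le (by nlinarith) ?_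
    push_cast
    refine (he p (hSprime p hp).one_lt).2.trans ?_
    have : (p : ℝ) ≤ ∏ p ∈ S, (p : ℝ) := by
      rw [← Nat.cast_prod]
      exact_mod_cast hle p hp
    gcongr

end CodeFamily

/-! ### Length estimates -/

/-- The inner exponent `(log n * (log log n) ^ (r - 1)) ^ (1 / r)`, as a function of a real. -/
noncomputable def lengthExponent (r : ℕ) (y : ℝ) : ℝ :=
  (Real.log y * Real.log (Real.log y) ^ (r - 1)) ^ (1 / (r : ℝ))

theorem log_log_pos {y : ℝ} (hy : 3 ≤ y) : 1 < Real.log y ∧ 0 < Real.log (Real.log y) := by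
  have h : 1 < Real.log y := by
    rw [Real.lt_log_iff_exp_lt (by linarith)]
    linarith [Real.exp_one_lt_d9]
  exact ⟨h, Real.log_pos h⟩

theorem one_le_log_log {y : ℝ} (hy : 16 ≤ y) : 1 ≤ Real.log (Real.log y) := by
  have h16 : Real.log 16 = 4 * Real.log 2 := by
    rw [show (16 : ℝ) = 2 ^ 4 by norm_num, Real.log_pow]
    norm_num
  have h : Real.exp 1 ≤ Real.log y := by
    have := Real.log_le_log (by norm_num) hy
    linarith [Real.exp_one_lt_d9, Real.log_two_gt_d9]
  rwa [Real.le_log_iff_exp_le ((Real.exp_pos 1).trans_le h)]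

theorem lengthExponent_pos (r : ℕ) {y : ℝ} (hy : 3 ≤ y) : 0 < lengthExponent r y := by
  obtain ⟨h1, h2⟩ := log_log_pos hy
  rw [lengthExponent]
  positivity

theorem lengthExponent_mono (r : ℕ) {y z : ℝ} (hy : 3 ≤ y) (hyz : y ≤ z) :
    lengthExponent r y ≤ lengthExponent r z := by
  obtain ⟨h1, h2⟩ := log_log_pos hy
  have h3 := Real.log_le_log (by linarith) hyz
  have h4 := Real.log_le_log (by linarith) h3
  rw [lengthExponent, lengthExponent]
  gcongr
  linarith

theorem one_le_lengthExponent (r : ℕ) {y : ℝ} (hy : 16 ≤ y) : 1 ≤ lengthExponent r y := by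
  obtain ⟨h1, -⟩ := log_log_pos (by linarith : 3 ≤ y)
  have h2 := one_le_log_log hy
  exact Real.one_le_rpow (one_le_mul_of_one_le_of_one_le h1.le (one_le_pow₀ h2)) (by positivity)

/-- In this form the first factor matches `w ^ (1 / r)` and the second `log (w ^ 2 + 1)`, up to
constants, when `w` has order `log y / log log y`. -/
theorem lengthExponent_eq {r : ℕ} (hr : 0 < r) {y : ℝ} (hy : 3 ≤ y) :
    lengthExponent r y =
      (Real.log y / Real.log (Real.log y)) ^ (1 / (r : ℝ)) * Real.log (Real.log y) := by
  obtain ⟨h1, h2⟩ := log_log_pos hy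
  have : Real.log y * Real.log (Real.log y) ^ (r - 1) =
      Real.log y / Real.log (Real.log y) * Real.log (Real.log y) ^ r := by
    obtain ⟨s, rfl⟩ := Nat.exists_eq_add_of_le' hr
    rw [Nat.add_sub_cancel, pow_succ]
    field_simp
  rw [lengthExponent, this, Real.mul_rpow (by positivity) (by positivity), one_div,
    Real.pow_rpow_inv_natCast h2.le hr.ne']

theorem log_mul_rpow_eq_lengthExponent {r : ℕ} (hr : 0 < r) {y : ℝ} (hy : 3 ≤ y) :
    Real.log y * (Real.log (Real.log y) / Real.log y) ^ (1 - 1 / (r : ℝ)) =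
      lengthExponent r y := by
  obtain ⟨h1, h2⟩ := log_log_pos hy
  rw [lengthExponent_eq hr hy, Real.rpow_sub (by positivity), Real.rpow_one,
    ← inv_div (Real.log y), Real.inv_rpow (by positivity)]
  have : (Real.log y / Real.log (Real.log y)) ^ (1 / (r : ℝ)) ≠ 0 := by positivity
  field_simp

theorem log_le_half {y : ℝ} (hy : 0 < y) : Real.log y ≤ y / 2 := by
  have h := Real.log_le_sub_one_of_pos (half_pos hy)
  rw [Real.log_div hy.ne' two_ne_zero] at h
  linarith [Real.log_two_lt_d9]

/-- `w` of order `log n / log log n` suffices for `n ≤ w ^ w`. -/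
theorem exists_le_pow_self {n : ℕ} (hn : 16 ≤ n) :
    ∃ w : ℕ, 0 < w ∧ n ≤ w ^ w ∧
      (w : ℝ) ≤ 3 * (Real.log n / Real.log (Real.log n)) := by
  have hn' : (16 : ℝ) ≤ n := by exact_mod_cast hn
  obtain ⟨h1, h2⟩ := log_log_pos (by linarith : 3 ≤ (n : ℝ))
  have h3 := one_le_log_log hn'
  set L := Real.log (n : ℝ)
  set K := Real.log L
  have hKL : K ≤ L := by linarith [Real.log_le_sub_one_of_pos (by linarith : 0 < L)]
  have hq : 1 ≤ L / K := (one_le_div h2).2 hKL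
  have hwle := (Nat.ceil_lt_add_one (by positivity : 0 ≤ 2 * (L / K))).le
  have hlew := Nat.le_ceil (2 * (L / K))
  set w := ⌈2 * (L / K)⌉₊
  have hw : (0 : ℝ) < w := by linarith
  refine ⟨w, by exact_mod_cast hw, ?_, by linarith⟩
  -- Since `w ≥ L / K`, `log w ≥ K - log K`, and `log K ≤ K / 2`.
  have hlogw : K / 2 ≤ Real.log w := by
    have h4 : Real.log (L / K) ≤ Real.log w := Real.log_le_log (by positivity) (by linarith)
    rw [Real.log_div (by positivity) h2.ne'] at h4
    linarith [log_le_half h2]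
  have h5 : L ≤ w * Real.log w :=
    calc L = 2 * (L / K) * (K / 2) := by field_simp
      _ ≤ w * Real.log w := by gcongr
  have h6 : (n : ℝ) ≤ (w : ℝ) ^ w := by
    rw [← Real.log_le_log_iff (by linarith) (by positivity), Real.log_pow]
    exact h5
  exact_mod_cast h6

theorem rpow_mul_log_le {r : ℕ} (hr : 0 < r) {y w : ℝ} (hy : 16 ≤ y) (hw : 0 ≤ w)
    (hwy : w ≤ 3 * (Real.log y / Real.log (Real.log y))) :
    w ^ (1 / (r : ℝ)) * Real.log (w ^ 2 + 1) ≤ 15 * lengthExponent r y := by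
  obtain ⟨h1, h2⟩ := log_log_pos (by linarith : 3 ≤ y)
  have h3 := one_le_log_log hy
  rw [lengthExponent_eq hr (by linarith)]
  set L := Real.log y
  set K := Real.log L with hK
  have hr1 : 1 / (r : ℝ) ≤ 1 := by
    rw [div_le_one (by positivity)]
    exact_mod_cast hr
  have hA : w ^ (1 / (r : ℝ)) ≤ 3 * (L / K) ^ (1 / (r : ℝ)) := by
    calc w ^ (1 / (r : ℝ)) ≤ (3 * (L / K)) ^ (1 / (r : ℝ)) := by gcongr
      _ = 3 ^ (1 / (r : ℝ)) * (L / K) ^ (1 / (r : ℝ)) := Real.mul_rpow (by norm_num) (by positivity)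
      _ ≤ 3 * (L / K) ^ (1 / (r : ℝ)) := by
        gcongr
        exact Real.rpow_le_self_of_one_le (by norm_num) hr1
  -- As `K ≥ 1`, `w ≤ 3 * L`, so `w ^ 2 + 1 ≤ 10 * L ^ 2`; moreover `log 10 ≤ 3 ≤ 3 * K`.
  have hB : Real.log (w ^ 2 + 1) ≤ 5 * K := by
    have hwL : w ≤ 3 * L := hwy.trans (by gcongr; exact div_le_self (by linarith) h3)
    have h10 : Real.log 10 ≤ 3 := by
      rw [Real.log_le_iff_le_exp (by norm_num)]
      have h27 : (2.7 : ℝ) ^ 3 ≤ Real.exp 1 ^ 3 := by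
        gcongr
        linarith [Real.exp_one_gt_d9]
      rw [← Real.exp_nat_mul] at h27
      norm_num at h27 ⊢
      linarith
    calc Real.log (w ^ 2 + 1) ≤ Real.log (10 * L ^ 2) :=
          Real.log_le_log (by positivity) (by nlinarith)
      _ = Real.log 10 + 2 * K := by
        rw [Real.log_mul (by norm_num) (by positivity), Real.log_pow]
        norm_num [hK]
      _ ≤ 5 * K := by linarith
  calc w ^ (1 / (r : ℝ)) * Real.log (w ^ 2 + 1) ≤ 3 * (L / K) ^ (1 / (r : ℝ)) * (5 * K) :=
        mul_le_mul hA hB (Real.log_nonneg (by nlinarith)) (by positivity)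
    _ = _ := by ring

/-- Taking logarithms, `M * w ^ (1 / r) * log (w ^ 2 + 1)` contributes 15 of the factor 16, and `log
(log M) ≤ M` the remaining 1, because the length exponent is at least 1. -/
theorem log_log_le_of_log_le {r : ℕ} (hr : 0 < r) {M N : ℕ} (hM : 3 ≤ M) (hN : 3 ≤ N) {y w : ℝ}
    (hy : 16 ≤ y) (hw : 0 ≤ w) (hwy : w ≤ 3 * (Real.log y / Real.log (Real.log y)))
    (h : Real.log N ≤ (w ^ 2 + 1) ^ (M * w ^ (1 / (r : ℝ))) * Real.log M) :
    Real.log (Real.log N) ≤ 16 * M * lengthExponent r y := by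
  have hM' : (3 : ℝ) ≤ M := by exact_mod_cast hM
  have hN' : (3 : ℝ) ≤ N := by exact_mod_cast hN
  obtain ⟨hM1, hM2⟩ := log_log_pos hM'
  obtain ⟨hN1, -⟩ := log_log_pos hN'
  have hpos : 0 < w ^ 2 + 1 := by positivity
  have h1 := Real.log_le_log (by linarith) h
  rw [Real.log_mul (by positivity) (by positivity), Real.log_rpow hpos] at h1
  have h2 := rpow_mul_log_le hr hy hw hwy
  have h3 : Real.log (Real.log M) ≤ M := by
    linarith [Real.log_le_sub_one_of_pos (by linarith : 0 < (M : ℝ)),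
      Real.log_le_sub_one_of_pos (by linarith : 0 < Real.log (M : ℝ))]
  have h4 := one_le_lengthExponent r hy
  have h5 := mul_le_mul_of_nonneg_left h2 (by linarith : 0 ≤ (M : ℝ))
  have h6 := mul_le_mul_of_nonneg_left h4 (by linarith : 0 ≤ (M : ℝ))
  linarith

/-- This absorbs the range from 3 to 16, where `log log y` may be below 1, into the constant. -/
theorem lengthExponent_max_le (r : ℕ) {y : ℝ} (hy : 3 ≤ y) :
    lengthExponent r (max y 16) ≤
      max 1 (lengthExponent r 16 / lengthExponent r 3) * lengthExponent r y := by
  have h3 := lengthExponent_pos r le_rfl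
  have hpos := lengthExponent_pos r hy
  rcases le_total 16 y with h | h
  · rw [max_eq_left h]
    exact le_mul_of_one_le_left hpos.le (le_max_left _ _)
  · rw [max_eq_right h]
    calc lengthExponent r 16
        = lengthExponent r 16 / lengthExponent r 3 * lengthExponent r 3 := by field_simp
      _ ≤ _ := mul_le_mul (le_max_right _ _) (lengthExponent_mono r le_rfl hy) h3.le
        (by positivity)

theorem mainTheorem2 (r : ℕ) (hr : 1 < r) :
    ∃ (t k : ℕ) (c : ℝ), 0 < t ∧ k ≤ 3 * 2 ^ (r - 2) ∧ 0 < c ∧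
      ∀ n : ℕ, 1 < n →
        ∃ (N : ℕ) (C : (Fin n → GaloisField 2 t) →ₗ[GaloisField 2 t] (Fin N → GaloisField 2 t)),
          HasPerfectlySmoothDecoder C k ∧
          (∀ δ : ℝ, 0 ≤ δ → IsLocallyDecodable C k δ ((k : ℝ) * δ)) ∧
          (3 ≤ n → ∃ θ : ℝ, 0 ≤ θ ∧ θ ≤ c ∧
            (N : ℝ) = Real.exp (Real.exp (θ *
              (Real.log (n : ℝ) * Real.log (Real.log (n : ℝ)) ^ (r - 1)) ^ (1 / (r : ℝ)))) ∧
            (N : ℝ) = Real.exp ((n : ℝ) ^ (θ *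
              (Real.log (Real.log (n : ℝ)) / Real.log (n : ℝ)) ^ (1 - 1 / (r : ℝ))))) := by
  obtain ⟨t, M, ht, hM, H⟩ := exists_code_family r hr
  have hr0 : 0 < r := by omega
  refine ⟨t, 3 * 2 ^ (r - 2),
    16 * M * max 1 (lengthExponent r 16 / lengthExponent r 3), ht, le_rfl, by positivity,
    fun n _ => ?_⟩
  -- Small `n` are embedded in the message space for 16, where the estimates hold.
  obtain ⟨w, hw, hnw, hwle⟩ := exists_le_pow_self (le_max_right n 16)
  obtain ⟨N, C, hC, hN, hlogN⟩ := H w n hw ((le_max_left n 16).trans hnw)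
  refine ⟨N, C, hC, fun δ hδ => hC.isLocallyDecodable hδ, fun hn => ?_⟩
  have hn' : (3 : ℝ) ≤ n := by exact_mod_cast hn
  have hmax : ((max n 16 : ℕ) : ℝ) = max (n : ℝ) 16 := by push_cast; rfl
  rw [hmax] at hwle
  have hbound := (log_log_le_of_log_le hr0 hM hN (le_max_right _ _) (by positivity) hwle
    hlogN).trans (mul_le_mul_of_nonneg_left (lengthExponent_max_le r hn') (by positivity))
  have hS := lengthExponent_pos r hn'
  obtain ⟨hN1, hN2⟩ := log_log_pos (by exact_mod_cast hN : (3 : ℝ) ≤ N)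
  have hNpos : (0 : ℝ) < N := by positivity
  have hexp : (N : ℝ) = Real.exp (Real.exp
      (Real.log (Real.log N) / lengthExponent r n * lengthExponent r n)) := by
    rw [div_mul_cancel₀ _ hS.ne', Real.exp_log (by linarith), Real.exp_log hNpos]
  -- The equality for `N` forces this `θ`; it is nonnegative because `N ≥ 3`.
  refine ⟨Real.log (Real.log N) / lengthExponent r n, by positivity, ?_, hexp, ?_⟩
  · rw [div_le_iff₀ hS]
    linarith
  · rw [Real.rpow_def_of_pos (by linarith), mul_left_comm,
      log_mul_rpow_eq_lengthExponent hr0 hn']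
    exact hexp
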